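/- Let $\mathfrak g=\mathfrak{sp}(4,\mathbb C)$ be the simple Lie algebra of type $C_2$, realised as the $4\times4$ matrices $x$ with $x^{T}J+Jx=0$, $J=\begin{pmatrix}0&-I_2\\ I_2&0\end{pmatrix}$. With matrix units $E_{ij}$, put $$e_{10}=E_{12}-E_{43},\quad e_{01}=E_{31},\quad e_{11}=-E_{32}-E_{41},\quad e_{21}=2E_{42},$$ $$f_{10}=E_{21}-E_{34},\quad f_{01}=E_{13},\quad f_{11}=-E_{14}-E_{23},\quad f_{21}=2E_{24},$$ $$h_{10}=E_{11}-E_{22}-E_{33}+E_{44},\quad h_{01}=-E_{11}+E_{33}.$$ Let $\mathfrak h=\mathbb C h_{10}\oplus\mathbb C h_{01}$ and let $U_0=U_0(C_2)$ be the centralizer of $\mathfrak h$ in the universal enveloping algebra $U(\mathfrak g)$. Consider the following elements of $U_0$ (the perfect monomials): $$h_1=h_{01},\ h_2=h_{10},\ c_1=f_{01}e_{01},\ c_2=f_{21}e_{21},\ c_3=f_{10}e_{10},\ c_4=f_{11}e_{11},$$ $$c_5=f_{11}e_{01}e_{10},\ c_6=f_{10}f_{01}e_{11},\ c_7=f_{21}e_{11}e_{10},\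 c_8=f_{10}f_{11}e_{21},$$ $$c_9=f_{21}e_{01}e_{10}e_{10},\ c_{10}=f_{10}f_{10}f_{01}e_{21},\ c_{11}=f_{01}f_{21}e_{11}e_{11},\ c_{12}=f_{11}f_{11}e_{21}e_{01}.$$ Let $F$ be the free associative $\mathbb C$-algebra on symbols denoted by the same letters $h_1,h_2,c_1,\dots,c_{12}$, let $\omega:F\to U_0$ send each symbol to the corresponding element, and let $K=\ker\omega$ be the ideal of relations. Order the symbols by $h_1<h_2<c_1<\dots<c_{12}$. Replacing each symbol in a word by the product that defines it gives a word in the basis of $\mathfrak g$ above; call two words in the symbols equivalent if these expansions are permutations of each other. A word is semi-perfect if it is the lexicographically smallest word in its equivalence class. A normal form $\mathcal N(x)$ of $x\in F$ is a linear combination of semi-perfect words with $\omega(\mathcal N(x))=\omega(x)$. Then: 1. The monomials $$h_1^{s_1}h_2^{s_2}c_1^{s_3}c_2^{s_4}c_3^{s_5}c_4^{s_6}c_m^{s_m}c_n^{s_n},\qquad (m,n)\in\{(5,9),(5,12),(6,10),(6,11),(7,9),(7,11),(8,10),(8,12)\},$$ with all exponents in $\mathbb N=\{0,1,2,\dots\}$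 form a basis of the vector space $U_0$. (Monomials with the same exponent vector, which may arise from different pairs $(m,n)$ when $s_m$ or $s_n$ is $0$, are counted once; distinct exponent vectors give distinct basis elements.) 2. Every $x\in F$ has exactly one normal form $\mathcal N(x)$, and the two-sided ideal $K$ of $F$ is generated by the relations of length two, namely $c_ic_j-\mathcal N(c_ic_j)$ for $1\le i,j\le 12$, together with the relations $xh_i-h_ix$ for $i=1,2$ and $x\in\{h_1,h_2,c_1,\dots,c_{12}\}$, which say that $h_1,h_2$ are central. -/

import Mathlib

noncomputable section

namespace CentralizerC2

attribute [local instance 100] LieRing.ofAssociativeRing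

/-- The symplectic Lie algebra `sp(4, ℂ)`, of type `C₂`, as matrices of size four. -/
abbrev g : LieSubalgebra ℂ (Matrix (Fin 2 ⊕ Fin 2) (Fin 2 ⊕ Fin 2) ℂ) :=
  LieAlgebra.Symplectic.sp (Fin 2) ℂ

/-- The matrix unit in row `i` and column `j`, rows and columns being numbered `0, 1, 2, 3`;
so `E 0 1` is what is usually written `E₁₂`. -/
def E (i j : Fin 4) : Matrix (Fin 2 ⊕ Fin 2) (Fin 2 ⊕ Fin 2) ℂ :=
  Matrix.single ((finSumFinEquiv : Fin 2 ⊕ Fin 2 ≃ Fin 4).symm i)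
    ((finSumFinEquiv : Fin 2 ⊕ Fin 2 ≃ Fin 4).symm j) 1

/-- Names of the elements of the Chevalley basis: `e_ab` has root `a α₁ + b α₂`, `f_ab` has the
opposite root, and `h10`, `h01` are the simple coroots. -/
inductive Letter
  | h10 | h01 | f10 | f01 | f11 | f21 | e21 | e11 | e01 | e10
  deriving DecidableEq

/-- The matrices of the Chevalley basis. -/
def Letter.matrix : Letter → Matrix (Fin 2 ⊕ Fin 2) (Fin 2 ⊕ Fin 2) ℂ
  | h10 => E 0 0 - E 1 1 - E 2 2 + E 3 3
  | h01 => -E 0 0 + E 2 2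
  | f10 => E 1 0 - E 2 3
  | f01 => E 0 2
  | f11 => -E 0 3 - E 1 2
  | f21 => (2 : ℂ) • E 1 3
  | e21 => (2 : ℂ) • E 3 1
  | e11 => -E 2 1 - E 3 0
  | e01 => E 2 0
  | e10 => E 0 1 - E 3 2

theorem Letter.matrix_mem (x : Letter) : x.matrix ∈ g := by
  have a0 : (finSumFinEquiv : Fin 2 ⊕ Fin 2 ≃ Fin 4).symm 0 = Sum.inl 0 := by decide
  have a1 : (finSumFinEquiv : Fin 2 ⊕ Fin 2 ≃ Fin 4).symm 1 = Sum.inl 1 := by decide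
  have a2 : (finSumFinEquiv : Fin 2 ⊕ Fin 2 ≃ Fin 4).symm 2 = Sum.inr 0 := by decide
  have a3 : (finSumFinEquiv : Fin 2 ⊕ Fin 2 ≃ Fin 4).symm 3 = Sum.inr 1 := by decide
  refine (mem_skewAdjointMatricesLieSubalgebra _ _).2 ((mem_skewAdjointMatricesSubmodule _ _).2 ?_)
  rw [Matrix.IsSkewAdjoint, Matrix.IsAdjointPair]
  ext i j
  rcases i with i | i <;> rcases j with j | j <;> fin_cases i <;> fin_cases j <;> cases x <;>
    simp [Letter.matrix, E, a0, a1, a2, a3, Matrix.J, Matrix.mul_apply, Matrix.single_apply]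

/-- The Chevalley basis of `sp(4, ℂ)`. -/
def Letter.toLie (x : Letter) : g := ⟨x.matrix, x.matrix_mem⟩

/-- The universal enveloping algebra `U(C₂)`. -/
abbrev U : Type := UniversalEnvelopingAlgebra ℂ g

/-- The Cartan subalgebra, spanned by the simple coroots. -/
def cartan : Submodule ℂ g := Submodule.span ℂ {Letter.h10.toLie, Letter.h01.toLie}

/-- `U₀(C₂)`: the centralizer of the Cartan subalgebra in `U(C₂)`. -/
def U₀ : Subalgebra ℂ U :=
  Subalgebra.centralizer ℂ ((UniversalEnvelopingAlgebra.ι ℂ : g → U) '' (cartan : Set g))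

/-- Names of the perfect monomials, in their order `h₁ < h₂ < c₁ < ⋯ < c₁₂`. -/
abbrev Gen : Type := Fin 14

/-- The name of `h₁` (for `i = 0`) and of `h₂` (for `i = 1`). -/
def hGen (i : Fin 2) : Gen := Fin.castAdd 12 i

/-- The name of `c_{k+1}`. -/
def cGen (k : Fin 12) : Gen := Fin.natAdd 2 k

open Letter in
/-- The word in the Chevalley basis that defines each perfect monomial. -/
def letters : Gen → List Letter :=
  ![[h01], [h10],
    [f01, e01], [f21, e21], [f10, e10], [f11, e11],
    [f11, e01, e10], [f10, f01, e11], [f21, e11, e10], [f10, f11, e21],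
    [f21, e01, e10, e10], [f10, f10, f01, e21], [f01, f21, e11, e11], [f11, f11, e21, e01]]

/-- The perfect monomials `h₁, h₂, c₁, …, c₁₂` as elements of `U(C₂)`. -/
def perfect (x : Gen) : U :=
  ((letters x).map fun y => UniversalEnvelopingAlgebra.ι ℂ y.toLie).prod

/-- The eight pairs `(m, n)`. -/
def pairs : List (ℕ × ℕ) :=
  [(5, 9), (5, 12), (6, 10), (6, 11), (7, 9), (7, 11), (8, 10), (8, 12)]

/-- The exponent vectors of the monomials
`h₁^s₁ h₂^s₂ c₁^s₃ c₂^s₄ c₃^s₅ c₄^s₆ c_m^s_m c_n^s_n` with `(m, n)` one of the eight pairs: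
among `c₅, …, c₁₂` only `c_m` and `c_n` may occur. Here `k : Fin 12` stands for `c_{k+1}`. -/
def Exponents : Type :=
  {s : Gen → ℕ // ∃ p ∈ pairs, ∀ k : Fin 12,
    5 ≤ (k : ℕ) + 1 → (k : ℕ) + 1 ≠ p.1 → (k : ℕ) + 1 ≠ p.2 → s (cGen k) = 0}

/-- The ordered monomial `h₁^s(h₁) h₂^s(h₂) c₁^s(c₁) ⋯ c₁₂^s(c₁₂)` in `U(C₂)`. -/
def monomial (s : Gen → ℕ) : U := (List.ofFn fun x : Gen => perfect x ^ s x).prod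

/-- The free associative algebra on the symbols `h₁, h₂, c₁, …, c₁₂`. -/
abbrev Free : Type := FreeAlgebra ℂ Gen

/-- The homomorphism that sends each symbol to its perfect monomial. -/
def ω : Free →ₐ[ℂ] U := FreeAlgebra.lift ℂ perfect

/-- The ideal of relations among the perfect monomials. -/
def K : TwoSidedIdeal Free := TwoSidedIdeal.ker ω

/-- A word in the symbols, as an element of the free algebra. -/
def ofWord (w : List Gen) : Free := (w.map (FreeAlgebra.ι ℂ)).prod

/-- The words whose expansion in the Chevalley basis is a permutation of that of `w`. -/
def T₁ (w : List Gen) : Set (List Gen) :=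
  {w' | (w'.flatMap letters).Perm (w.flatMap letters)}

/-- Semi-perfect words: those that are lexicographically minimal in their class. (No word of a
class is a proper prefix of another one, so it does not matter how the order treats prefixes.) -/
def SemiPerfect (w : List Gen) : Prop := IsLeast (T₁ w) w

/-- `n` is a normal form of `x`: a linear combination of semi-perfect words with the same value
in `U(C₂)`. -/
def IsNormalForm (x n : Free) : Prop :=
  n ∈ Submodule.span ℂ (ofWord '' {w | SemiPerfect w}) ∧ ω n = ω x

/-- The relations `c_{i₁} ⋯ c_{iₘ} - 𝒩(c_{i₁} ⋯ c_{iₘ})` of length `m`, where `𝒩` is the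
normal form. -/
def relationsOfLength (m : ℕ) : Set Free :=
  {r | ∃ (w : List (Fin 12)) (n : Free), w.length = m ∧
    IsNormalForm (ofWord (w.map cGen)) n ∧ r = ofWord (w.map cGen) - n}

/-- The relations `x h_i - h_i x`, for `x` one of the symbols. -/
def centralityRelations : Set Free :=
  {r | ∃ (i : Fin 2) (x : Gen), r = FreeAlgebra.ι ℂ x * FreeAlgebra.ι ℂ (hGen i) -
    FreeAlgebra.ι ℂ (hGen i) * FreeAlgebra.ι ℂ x}

end CentralizerC2

end

noncomputable section

namespace CentralizerC2

attribute [local instance 100] LieRing.ofAssociativeRing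

/-! Everything reduces to multisets of Chevalley letters. Modulo shorter words of the same weight, a
word in U depends only on its multiset of letters (`wordU_sub_mem_wordSpan`), and words with
distinct multisets are independent (`linearIndependent_wordU`). The latter, the hard half of PBW,
comes from letting sp(4) act on polynomial functions of a matrix by left-invariant vector fields and
testing words on products of coordinates that vanish at the identity. Since U₀ is the weight-zero
part of U, it is spanned by words of weight zero (`mem_span_of_mem_U₀`).

The combinatorial core: each weight-zero multiset is the expansion of exactly one sorted product of
perfect monomials whose factors among c₅, …, c₁₂ carry no two opposite root vectors
(`exists_reduced_perm`, `Reduced.eq_of_perm`). These products have exactly the listed exponents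
(`reduced_iff`) and are exactly the semi-perfect words. Basis and normal forms follow.

For the relations, ω is injective on the span of semi-perfect words, so it suffices to rewrite every
word into semi-perfect ones by the given relations. These make symbols commute modulo lower degree
(`wordCongr_swap`), and replace two of c₅, …, c₁₂ carrying opposite root vectors by a product
containing one of c₁, …, c₄ (`exists_wordCongr_highDegree_lt`). The rewriting ends by induction on
the degree, then on the share of the degree carried by c₅, …, c₁₂. -/

/-- The polynomial functions on square matrices. -/
abbrev MatPoly (n : Type*) : Type _ := MvPolynomial (n × n) ℂ

/-! ### Left-invariant vector fields and orders of vanishing at the identity. -/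

section Derivations

variable {n : Type*} [Fintype n]

/-- The left-invariant vector field attached to a matrix, acting on polynomial functions. -/
def invField (A : Matrix n n ℂ) : Derivation ℂ (MatPoly n) (MatPoly n) :=
  MvPolynomial.mkDerivation ℂ fun p => ∑ k, A k p.2 • MvPolynomial.X (p.1, k)

theorem invField_X (A : Matrix n n ℂ) (i j : n) :
    invField A (MvPolynomial.X (i, j)) = ∑ k, A k j • MvPolynomial.X (i, k) := by
  simp [invField]

variable [DecidableEq n]

/-- Matrices act on polynomial functions by left-invariant vector fields. -/
def invFieldHom : Matrix n n ℂ →ₗ⁅ℂ⁆ Module.End ℂ (MatPoly n) where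
  toFun A := (invField A : MatPoly n →ₗ[ℂ] MatPoly n)
  map_add' A B := by
    have : invField (A + B) = invField A + invField B := by
      refine MvPolynomial.derivation_ext fun ⟨i, j⟩ => ?_
      simp [invField_X, add_smul, Finset.sum_add_distrib]
    rw [this]; rfl
  map_smul' c A := by
    have : invField (c • A) = c • invField A := by
      refine MvPolynomial.derivation_ext fun ⟨i, j⟩ => ?_
      simp [invField_X, Finset.smul_sum, mul_smul]
    rw [this]; rfl
  map_lie' {A B} := by
    -- The field of A sends the generic matrix X to XA; applying that of B and then that of A gives
    -- XAB, so the order of products is kept.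
    have : invField ⁅A, B⁆ = ⁅invField A, invField B⁆ := by
      refine MvPolynomial.derivation_ext fun ⟨i, j⟩ => ?_
      rw [Derivation.commutator_apply]
      simp only [invField_X, map_sum, Derivation.map_smul, Finset.smul_sum,
        LieRing.of_associative_ring_bracket, Matrix.sub_apply, Matrix.mul_apply, sub_smul,
        Finset.sum_smul, Finset.sum_sub_distrib, smul_smul]
      rw [Finset.sum_comm]
      congr 1
      · exact Finset.sum_congr rfl fun _ _ => Finset.sum_congr rfl fun _ _ => by rw [mul_comm]
      · rw [Finset.sum_comm]
        exact Finset.sum_congr rfl fun _ _ => Finset.sum_congr rfl fun _ _ => by rw [mul_comm]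
    rw [this]; exact Derivation.commutator_coe_linear_map

/-- Evaluation of polynomial functions at the identity matrix. -/
def evalOne : MatPoly n →ₐ[ℂ] ℂ := MvPolynomial.aeval fun p => (1 : Matrix n n ℂ) p.1 p.2

/-- The polynomial functions that vanish at the identity matrix. -/
def maxOne (n : Type*) [Fintype n] [DecidableEq n] : Ideal (MatPoly n) :=
  RingHom.ker (evalOne : MatPoly n →ₐ[ℂ] ℂ)

/-- A linear form on matrices as a polynomial function, shifted so as to vanish at the identity. -/
def linPoly (φ : Matrix n n ℂ →ₗ[ℂ] ℂ) : MatPoly n :=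
  ∑ p : n × n, φ (Matrix.single p.1 p.2 1) •
    (MvPolynomial.X p - MvPolynomial.C ((1 : Matrix n n ℂ) p.1 p.2))

theorem linPoly_mem (φ : Matrix n n ℂ →ₗ[ℂ] ℂ) : linPoly φ ∈ maxOne n := by
  simp [linPoly, maxOne, RingHom.mem_ker, evalOne]

/-- At the identity the field of A is the tangent vector A, and `linPoly φ` has differential φ. -/
theorem evalOne_invField_linPoly (A : Matrix n n ℂ) (φ : Matrix n n ℂ →ₗ[ℂ] ℂ) :
    evalOne (invField A (linPoly φ)) = φ A := by
  have h : ∀ p : n × n, evalOne (invField A (MvPolynomial.X p)) = A p.1 p.2 := by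
    rintro ⟨i, j⟩
    simp [invField_X, evalOne, Matrix.one_apply]
  have hA : A = ∑ p : n × n, A p.1 p.2 • Matrix.single p.1 p.2 (1 : ℂ) := by
    conv_lhs => rw [Matrix.matrix_eq_sum_single A]
    simp [Fintype.sum_prod_type, Matrix.smul_single]
  conv_rhs => rw [hA]
  simp only [linPoly, map_sum, map_smul, Derivation.map_smul, map_sub, h,
    MvPolynomial.derivation_C, sub_zero, smul_eq_mul]
  exact Finset.sum_congr rfl fun _ _ => mul_comm _ _

theorem invField_linPoly_sub_mem (A : Matrix n n ℂ) (φ : Matrix n n ℂ →ₗ[ℂ] ℂ) :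
    invField A (linPoly φ) - MvPolynomial.C (φ A) ∈ maxOne n := by
  rw [maxOne, RingHom.mem_ker, map_sub, evalOne_invField_linPoly]
  simp [evalOne]

/-- By the Leibniz rule, a derivation lowers the order of vanishing by at most one. -/
theorem invField_mem_pow (A : Matrix n n ℂ) (k : ℕ) {f : MatPoly n}
    (hf : f ∈ maxOne n ^ (k + 1)) : invField A f ∈ maxOne n ^ k := by
  induction k generalizing f with
  | zero => simp
  | succ k ih =>
    rw [pow_succ] at hf
    induction hf using Submodule.mul_induction_on' with
    | mem_mul_mem a ha b hb =>
      rw [Derivation.leibniz, smul_eq_mul, smul_eq_mul]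
      refine add_mem (Ideal.mul_mem_right _ _ ha) ?_
      rw [pow_succ']
      exact Ideal.mul_mem_mul hb (ih ha)
    | add a _ b _ h₁ h₂ => rw [map_add]; exact add_mem h₁ h₂

end Derivations

/-! ### Linear independence of words with distinct letter multisets. -/

/-- Row and column index `i` of a matrix of size four. -/
def idx (i : Fin 4) : Fin 2 ⊕ Fin 2 := (finSumFinEquiv : Fin 2 ⊕ Fin 2 ≃ Fin 4).symm i

theorem idx_zero : idx 0 = Sum.inl 0 := by decide
theorem idx_one : idx 1 = Sum.inl 1 := by decide
theorem idx_two : idx 2 = Sum.inr 0 := by decide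
theorem idx_three : idx 3 = Sum.inr 1 := by decide

theorem E_eq (i j : Fin 4) : E i j = Matrix.single (idx i) (idx j) 1 := rfl

/-- The linear form that reads off a matrix entry. -/
def entry (i j : Fin 4) : Matrix (Fin 2 ⊕ Fin 2) (Fin 2 ⊕ Fin 2) ℂ →ₗ[ℂ] ℂ :=
  Matrix.entryLinearMap ℂ ℂ (idx i) (idx j)

/-- Linear forms on matrices that restrict to the dual of the Chevalley basis. -/
def Letter.coef : Letter → Matrix (Fin 2 ⊕ Fin 2) (Fin 2 ⊕ Fin 2) ℂ →ₗ[ℂ] ℂ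
  | h10 => -entry 1 1
  | h01 => -entry 0 0 - entry 1 1
  | f10 => entry 1 0
  | f01 => entry 0 2
  | f11 => -entry 0 3
  | f21 => (2⁻¹ : ℂ) • entry 1 3
  | e21 => (2⁻¹ : ℂ) • entry 3 1
  | e11 => -entry 2 1
  | e01 => entry 2 0
  | e10 => entry 0 1

theorem Letter.coef_matrix (x y : Letter) : x.coef y.matrix = if x = y then 1 else 0 := by
  cases x <;> cases y <;>
    simp [Letter.coef, Letter.matrix, entry, E_eq, idx_zero, idx_one, idx_two, idx_three]

/-- A word in the Chevalley basis as an element of the universal enveloping algebra. -/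
def wordU (w : List Letter) : U := (w.map fun y => UniversalEnvelopingAlgebra.ι ℂ y.toLie).prod

@[simp] theorem wordU_nil : wordU [] = 1 := rfl

@[simp] theorem wordU_cons (x : Letter) (w : List Letter) :
    wordU (x :: w) = UniversalEnvelopingAlgebra.ι ℂ x.toLie * wordU w := rfl

theorem wordU_append (v w : List Letter) : wordU (v ++ w) = wordU v * wordU w := by
  simp [wordU]

theorem perfect_eq (x : Gen) : perfect x = wordU (letters x) := rfl

/-- The action of `U(C₂)` on polynomial functions on matrices. -/
def rep : U →ₐ[ℂ] Module.End ℂ (MatPoly (Fin 2 ⊕ Fin 2)) :=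
  UniversalEnvelopingAlgebra.lift ℂ (invFieldHom.comp g.incl)

theorem rep_ι (x : Letter) (f : MatPoly (Fin 2 ⊕ Fin 2)) :
    rep (UniversalEnvelopingAlgebra.ι ℂ x.toLie) f = invField x.matrix f := by
  rw [rep, UniversalEnvelopingAlgebra.lift_ι_apply]
  rfl

theorem rep_wordU_cons (x : Letter) (w : List Letter) (f : MatPoly (Fin 2 ⊕ Fin 2)) :
    rep (wordU (x :: w)) f = invField x.matrix (rep (wordU w) f) := by
  rw [wordU_cons, map_mul, Module.End.mul_apply, rep_ι]

/-- The test function attached to a multiset of letters. -/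
def testFn (S : Multiset Letter) : MatPoly (Fin 2 ⊕ Fin 2) :=
  (S.map fun z => linPoly z.coef).prod

theorem testFn_cons (x : Letter) (S : Multiset Letter) :
    testFn (x ::ₘ S) = linPoly x.coef * testFn S := by
  simp [testFn]

theorem testFn_mem (S : Multiset Letter) : testFn S ∈ maxOne (Fin 2 ⊕ Fin 2) ^ S.card := by
  induction S using Multiset.induction_on with
  | empty => simp
  | cons x S ih =>
    rw [testFn_cons, Multiset.card_cons, pow_succ']
    exact Ideal.mul_mem_mul (linPoly_mem _) ih

/-- To leading order at the identity, a letter acts on monomials in the dual coordinates as the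
partial derivative in its own coordinate. -/
theorem invField_testFn (x : Letter) (S : Multiset Letter) :
    invField x.matrix (testFn S) - (S.count x : ℂ) • testFn (S.erase x) ∈
      maxOne (Fin 2 ⊕ Fin 2) ^ S.card := by
  induction S using Multiset.induction_on with
  | empty => simp
  | cons z S ih =>
    have h₁ := Ideal.mul_mem_mul (linPoly_mem z.coef) ih
    have h₂ := Ideal.mul_mem_mul (invField_linPoly_sub_mem x.matrix z.coef) (testFn_mem S)
    rw [Multiset.card_cons, pow_succ']
    convert add_mem h₁ h₂ using 1
    rw [testFn_cons, Derivation.leibniz, Letter.coef_matrix]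
    simp only [smul_eq_mul]
    by_cases hzx : z = x
    · subst hzx
      simp only [Multiset.count_cons_self, Multiset.erase_cons_head, if_true, map_one]
      -- If z does not occur in S, erasing it changes nothing, but then the coefficient is zero.
      have : (S.count z : ℂ) • testFn S =
          (S.count z : ℂ) • (linPoly z.coef * testFn (S.erase z)) := by
        by_cases hz : z ∈ S
        · rw [← testFn_cons, Multiset.cons_erase hz]
        · simp [Multiset.count_eq_zero_of_notMem hz]
      push_cast
      rw [add_smul, this, one_smul, mul_sub, mul_smul_comm]
      ring
    · rw [Multiset.count_cons_of_ne (Ne.symm hzx), Multiset.erase_cons_tail _ hzx, testFn_cons,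
        if_neg hzx, map_zero, mul_sub, mul_smul_comm]
      ring

/-- Iterated leading-order differentiation: c is a product of falling factorials of the
multiplicities in S, and the error vanishes to one order more than the main term. -/
theorem rep_wordU_testFn (S : Multiset Letter) (w : List Letter) (hw : w.length ≤ S.card) :
    ∃ c : ℂ, (c ≠ 0 ↔ (w : Multiset Letter) ≤ S) ∧
      rep (wordU w) (testFn S) - c • testFn (S - w) ∈
        maxOne (Fin 2 ⊕ Fin 2) ^ (S.card - w.length + 1) := by
  induction w with
  | nil => exact ⟨1, by simp⟩
  | cons x w ih =>
    rw [List.length_cons] at hw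
    obtain ⟨c, hc, hmem⟩ := ih (by omega)
    refine ⟨c * ((S - (w : Multiset Letter)).count x : ℂ), ?_, ?_⟩
    · rw [mul_ne_zero_iff, hc, Nat.cast_ne_zero, ← Multiset.cons_coe, Multiset.le_iff_count,
        Multiset.le_iff_count, Multiset.count_sub]
      constructor
      · rintro ⟨h₁, h₂⟩ a
        have := h₁ a
        rw [Multiset.count_cons]
        split_ifs with hax
        · subst hax; omega
        · omega
      · intro h
        refine ⟨fun a => le_trans (Multiset.count_le_count_cons _ _ _) (h a), ?_⟩
        have := h x
        rw [Multiset.count_cons_self] at this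
        omega
    · have hs : S - ((x :: w : List Letter) : Multiset Letter) =
          (S - (w : Multiset Letter)).erase x := by
        ext a
        rw [← Multiset.cons_coe, Multiset.sub_cons, Multiset.count_sub]
        by_cases hax : a = x
        · subst hax
          rw [Multiset.count_erase_self, Multiset.count_erase_self, Multiset.count_sub]
          omega
        · rw [Multiset.count_erase_of_ne hax, Multiset.count_erase_of_ne hax, Multiset.count_sub]
      have hk : S.card - w.length = S.card - (x :: w).length + 1 := by
        rw [List.length_cons]; omega
      have hcard : S.card - w.length ≤ (S - (w : Multiset Letter)).card := by
        have := Multiset.card_le_card (le_tsub_add (a := (w : Multiset Letter)) (b := S))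
        rw [Multiset.card_add, Multiset.coe_card] at this
        omega
      have h₁ := invField_mem_pow x.matrix _ hmem
      have h₂ := Ideal.pow_le_pow_right hcard (invField_testFn x (S - (w : Multiset Letter)))
      rw [rep_wordU_cons, hs, ← hk]
      convert add_mem h₁ (Submodule.smul_of_tower_mem _ c h₂) using 1
      rw [map_sub, Derivation.map_smul, smul_sub, mul_smul]
      abel

theorem evalOne_rep_wordU_testFn {S : Multiset Letter} {w : List Letter}
    (hw : w.length ≤ S.card) :
    evalOne (rep (wordU w) (testFn S)) ≠ 0 ↔ (w : Multiset Letter) = S := by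
  obtain ⟨c, hc, hmem⟩ := rep_wordU_testFn S w hw
  have h := (Ideal.pow_le_self (Nat.succ_ne_zero _) hmem)
  rw [maxOne, RingHom.mem_ker, map_sub, map_smul, sub_eq_zero] at h
  rw [h, smul_eq_mul, mul_ne_zero_iff, hc]
  constructor
  · rintro ⟨h₁, h₂⟩
    by_contra hne
    have hlt := Multiset.card_lt_card (lt_of_le_of_ne h₁ hne)
    refine h₂ (RingHom.mem_ker.1 (Ideal.pow_le_self (n := (S - (w : Multiset Letter)).card) ?_
      (testFn_mem _)))
    rw [Multiset.card_sub h₁]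
    omega
  · rintro rfl
    simp [testFn]

/-- In a vanishing combination, take a longest word of the support: its test function, evaluated at
the identity, detects that word and no other word of the support. -/
theorem linearIndependent_wordU {κ : Type*} (w : κ → List Letter)
    (hw : ∀ i j, (w i).Perm (w j) → i = j) : LinearIndependent ℂ fun i => wordU (w i) := by
  rw [linearIndependent_iff]
  intro l hl
  by_contra hne
  obtain ⟨i, hi, hmax⟩ := Finset.exists_max_image l.support (fun i => (w i).length)
    (Finsupp.support_nonempty_iff.2 hne)
  have h := congrArg (fun u => evalOne (rep u (testFn (w i)))) hl
  simp only [Finsupp.linearCombination_apply, Finsupp.sum, map_sum, map_smul, map_zero,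
    LinearMap.sum_apply, LinearMap.smul_apply, LinearMap.zero_apply, smul_eq_mul] at h
  rw [Finset.sum_eq_single_of_mem i hi] at h
  · refine mul_ne_zero (Finsupp.mem_support_iff.1 hi) ?_ h
    exact (evalOne_rep_wordU_testFn (by simp)).2 rfl
  · intro j hj hji
    rw [mul_eq_zero]
    right
    by_contra h0
    exact hji (hw j i (Multiset.coe_eq_coe.1
      ((evalOne_rep_wordU_testFn (by simpa using hmax j hj)).1 h0)))

/-! ### Weights, reordering of words, and U₀ as the weight-zero part. -/

instance : Fintype Letter where
  elems := {.h10, .h01, .f10, .f01, .f11, .f21, .e21, .e11, .e01, .e10}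
  complete x := by cases x <;> decide

/-- The weights of the standard representation. -/
def idxWt : Fin 2 ⊕ Fin 2 → ℤ × ℤ :=
  Sum.elim ![(1, 0), (0, 1)] ![(-1, 0), (0, -1)]

/-- The root of an element of the Chevalley basis. -/
def Letter.wt : Letter → ℤ × ℤ
  | h10 => 0
  | h01 => 0
  | f10 => (-1, 1)
  | f01 => (2, 0)
  | f11 => (1, 1)
  | f21 => (0, 2)
  | e21 => (0, -2)
  | e11 => (-1, -1)
  | e01 => (-2, 0)
  | e10 => (1, -1)

/-- The weight of a word. -/
def wtW (w : List Letter) : ℤ × ℤ := (w.map Letter.wt).sum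

@[simp] theorem wtW_nil : wtW [] = 0 := rfl

@[simp] theorem wtW_cons (x : Letter) (w : List Letter) : wtW (x :: w) = x.wt + wtW w := by
  simp [wtW]

theorem wtW_append (v w : List Letter) : wtW (v ++ w) = wtW v + wtW w := by simp [wtW]

theorem wtW_perm {v w : List Letter} (h : v.Perm w) : wtW v = wtW w := (h.map _).sum_eq

/-- A matrix that is a weight vector for the adjoint action of the torus. -/
def IsGraded (M : Matrix (Fin 2 ⊕ Fin 2) (Fin 2 ⊕ Fin 2) ℂ) (l : ℤ × ℤ) : Prop :=
  ∀ i j, M i j ≠ 0 → idxWt i - idxWt j = l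

/-- The signs in `Letter.wt` reflect the simple roots ε₁ - ε₂ and -2ε₁ of this realisation. -/
theorem Letter.isGraded (x : Letter) : IsGraded x.matrix x.wt := by
  intro i j h
  contrapose! h
  revert h
  rcases i with i | i <;> rcases j with j | j <;> fin_cases i <;> fin_cases j <;> cases x <;>
    simp [Letter.matrix, Letter.wt, idxWt, E_eq, idx_zero, idx_one, idx_two, idx_three]

theorem IsGraded.mul {M N : Matrix (Fin 2 ⊕ Fin 2) (Fin 2 ⊕ Fin 2) ℂ} {l m : ℤ × ℤ}
    (hM : IsGraded M l) (hN : IsGraded N m) : IsGraded (M * N) (l + m) := by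
  intro i j h
  rw [Matrix.mul_apply] at h
  obtain ⟨k, -, hk⟩ := Finset.exists_ne_zero_of_sum_ne_zero h
  rw [← hM i k (left_ne_zero_of_mul hk), ← hN k j (right_ne_zero_of_mul hk)]
  abel

theorem IsGraded.sub {M N : Matrix (Fin 2 ⊕ Fin 2) (Fin 2 ⊕ Fin 2) ℂ} {l : ℤ × ℤ}
    (hM : IsGraded M l) (hN : IsGraded N l) : IsGraded (M - N) l := by
  intro i j h
  by_cases hi : M i j = 0
  · exact hN i j fun h0 => h (by simp [hi, h0])
  · exact hM i j hi

theorem IsGraded.coef_eq_zero {M : Matrix (Fin 2 ⊕ Fin 2) (Fin 2 ⊕ Fin 2) ℂ} {l : ℤ × ℤ}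
    (hM : IsGraded M l) {z : Letter} (hz : z.wt ≠ l) : z.coef M = 0 := by
  have key : ∀ i j, idxWt (idx i) - idxWt (idx j) = z.wt → entry i j M = 0 := fun i j hij => by
    by_contra h
    exact hz (hij.symm.trans (hM _ _ h))
  cases z <;>
    simp only [Letter.coef, LinearMap.neg_apply, LinearMap.sub_apply, LinearMap.smul_apply] <;>
    repeat rw [key]
  all_goals first | decide | simp

theorem sum_letter {A : Type*} [AddCommMonoid A] (f : Letter → A) :
    ∑ z, f z = f .h10 + (f .h01 + (f .f10 + (f .f01 + (f .f11 + (f .f21 + (f .e21 + (f .e11 +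
      (f .e01 + f .e10)))))))) := by
  change ∑ z ∈ {.h10, .h01, .f10, .f01, .f11, .f21, .e21, .e11, .e01, .e10}, f z = _
  simp

theorem eq_sum_coef_smul {M : Matrix (Fin 2 ⊕ Fin 2) (Fin 2 ⊕ Fin 2) ℂ} (hM : M ∈ g) :
    M = ∑ z : Letter, z.coef M • z.matrix := by
  have h := (mem_skewAdjointMatricesSubmodule _ _).1
    ((mem_skewAdjointMatricesLieSubalgebra _ _).1 hM)
  rw [Matrix.IsSkewAdjoint, Matrix.IsAdjointPair] at h
  have h' := fun i j => congrFun (congrFun h i) j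
  have h₂ := h' (.inl 0) (.inl 1)
  have h₄ := h' (.inl 0) (.inr 0)
  have h₅ := h' (.inl 0) (.inr 1)
  have h₆ := h' (.inl 1) (.inr 0)
  have h₇ := h' (.inl 1) (.inr 1)
  have h₈ := h' (.inr 0) (.inr 1)
  simp [Matrix.mul_apply, Matrix.J, Matrix.one_apply] at h₂ h₄ h₅ h₆ h₇ h₈
  ext i j
  rw [sum_letter]
  rcases i with i | i <;> rcases j with j | j <;> fin_cases i <;> fin_cases j <;>
    simp [Letter.matrix, Letter.coef, entry, E_eq, idx_zero, idx_one, idx_two, idx_three,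
      h₂, ← h₄, ← h₅, ← h₆, ← h₇, h₈]
  all_goals ring

theorem toLie_eq_sum (x : g) : x = ∑ z : Letter, z.coef x.1 • z.toLie := by
  refine Subtype.ext ?_
  conv_lhs => rw [eq_sum_coef_smul x.2]
  rw [AddSubmonoidClass.coe_finsetSum]
  rfl

/-- The span of the words of a given weight and of bounded length. -/
def wordSpan (l : ℤ × ℤ) (n : ℕ) : Submodule ℂ U :=
  Submodule.span ℂ (wordU '' {w | wtW w = l ∧ w.length < n})

theorem wordU_mem_wordSpan {l : ℤ × ℤ} {n : ℕ} {w : List Letter} (hl : wtW w = l)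
    (hn : w.length < n) : wordU w ∈ wordSpan l n :=
  Submodule.subset_span ⟨w, ⟨hl, hn⟩, rfl⟩

theorem ι_mul_mem_wordSpan (x : Letter) {l : ℤ × ℤ} {n : ℕ} {u : U} (hu : u ∈ wordSpan l n) :
    UniversalEnvelopingAlgebra.ι ℂ x.toLie * u ∈ wordSpan (x.wt + l) (n + 1) := by
  have : wordSpan l n ≤ (wordSpan (x.wt + l) (n + 1)).comap
      (LinearMap.mulLeft ℂ (UniversalEnvelopingAlgebra.ι ℂ x.toLie)) := by
    refine Submodule.span_le.2 ?_
    rintro _ ⟨w, ⟨hl, hn⟩, rfl⟩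
    exact wordU_mem_wordSpan (w := x :: w) (by simp [hl]) (by simpa using hn)
  exact this hu

/-- A bracket merges two letters into letters of the total weight, so the length drops by one; this
is the error of an adjacent swap. -/
theorem ι_lie_mul_mem_wordSpan (x y : Letter) (w : List Letter) :
    UniversalEnvelopingAlgebra.ι ℂ ⁅x.toLie, y.toLie⁆ * wordU w ∈
      wordSpan (x.wt + y.wt + wtW w) (w.length + 2) := by
  rw [toLie_eq_sum ⁅x.toLie, y.toLie⁆, map_sum, Finset.sum_mul]
  refine sum_mem fun z _ => ?_
  rw [map_smul, smul_mul_assoc]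
  by_cases hz : z.wt = x.wt + y.wt
  · exact Submodule.smul_mem _ _ (wordU_mem_wordSpan (w := z :: w) (by simp [hz]) (by simp))
  · have : z.coef (⁅x.toLie, y.toLie⁆ : g).1 = 0 := by
      refine IsGraded.coef_eq_zero (l := x.wt + y.wt) ?_ hz
      refine IsGraded.sub (x.isGraded.mul y.isGraded) ?_
      rw [add_comm]
      exact y.isGraded.mul x.isGraded
    rw [this, zero_smul]
    exact zero_mem _

theorem wordU_sub_mem_wordSpan {v w : List Letter} (h : v.Perm w) :
    wordU v - wordU w ∈ wordSpan (wtW v) v.length := by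
  induction h with
  | nil => simp
  | cons x _ ih =>
    rw [wordU_cons, wordU_cons, ← mul_sub, wtW_cons, List.length_cons]
    exact ι_mul_mem_wordSpan x ih
  | swap x y l =>
    have := ι_lie_mul_mem_wordSpan y x l
    rw [LieHom.map_lie, LieRing.of_associative_ring_bracket, sub_mul, mul_assoc, mul_assoc,
      add_assoc] at this
    exact this
  | trans h₁ _ ih₁ ih₂ =>
    rw [← wtW_perm h₁, ← h₁.length_eq] at ih₂
    simpa using add_mem ih₁ ih₂

theorem span_wordU : Submodule.span ℂ (Set.range wordU) = ⊤ := by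
  let S : Subalgebra ℂ U :=
    Algebra.adjoin ℂ (Set.range fun x : Letter => UniversalEnvelopingAlgebra.ι ℂ x.toLie)
  have hg : ∀ x : g, UniversalEnvelopingAlgebra.ι ℂ x ∈ S := fun x => by
    rw [toLie_eq_sum x, map_sum]
    refine sum_mem fun z _ => ?_
    rw [map_smul]
    exact S.smul_mem (Algebra.subset_adjoin ⟨z, rfl⟩) _
  let φ : g →ₗ⁅ℂ⁆ S :=
    { toFun := fun x => ⟨UniversalEnvelopingAlgebra.ι ℂ x, hg x⟩
      map_add' := fun x y => Subtype.ext (map_add _ x y)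
      map_smul' := fun c x => Subtype.ext (map_smul _ c x)
      map_lie' := fun {x y} => Subtype.ext (LieHom.map_lie _ x y) }
  -- By the universal property, U maps to the subalgebra generated by the letters; followed by
  -- inclusion this is the identity, so that subalgebra is all of U.
  have hφ : S.val.comp (UniversalEnvelopingAlgebra.lift ℂ φ) = AlgHom.id ℂ U := by
    refine UniversalEnvelopingAlgebra.hom_ext ℂ (LieHom.ext fun x => ?_)
    change ((UniversalEnvelopingAlgebra.lift ℂ φ) (UniversalEnvelopingAlgebra.ι ℂ x) : U) =
      UniversalEnvelopingAlgebra.ι ℂ x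
    rw [UniversalEnvelopingAlgebra.lift_ι_apply]
    rfl
  refine Submodule.eq_top_iff'.2 fun u => ?_
  have hu : u ∈ S := by
    have : ((UniversalEnvelopingAlgebra.lift ℂ φ u : S) : U) = u := DFunLike.congr_fun hφ u
    rw [← this]
    exact Subtype.property _
  rw [← Subalgebra.mem_toSubmodule, Algebra.adjoin_eq_span] at hu
  refine Submodule.span_mono ?_ hu
  intro v hv
  induction hv using Submonoid.closure_induction with
  | mem _ hx => obtain ⟨x, rfl⟩ := hx; exact ⟨[x], by simp⟩
  | one => exact ⟨[], rfl⟩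
  | mul _ _ _ _ ha hb =>
    obtain ⟨a, rfl⟩ := ha
    obtain ⟨b, rfl⟩ := hb
    exact ⟨a ++ b, wordU_append a b⟩

/-- The element `diag(a, b, -a, -b)` of the Cartan subalgebra. -/
def diagLie (a b : ℂ) : g := (-b) • Letter.h10.toLie + (-b - a) • Letter.h01.toLie

/-- The value of a weight at `diag(a, b, -a, -b)`. -/
def evalWt (a b : ℂ) : ℤ × ℤ →+ ℂ where
  toFun l := l.1 * a + l.2 * b
  map_zero' := by simp
  map_add' l m := by push_cast [Prod.fst_add, Prod.snd_add]; ring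

theorem evalWt_apply (a b : ℂ) (l : ℤ × ℤ) : evalWt a b l = l.1 * a + l.2 * b := rfl

theorem diagLie_coe (a b : ℂ) :
    (diagLie a b).1 = Matrix.diagonal fun i => evalWt a b (idxWt i) := by
  change (-b) • Letter.h10.matrix + (-b - a) • Letter.h01.matrix = _
  ext i j
  rcases i with i | i <;> rcases j with j | j <;> fin_cases i <;> fin_cases j <;>
    simp [Letter.matrix, evalWt_apply, idxWt, E_eq, idx_zero, idx_one, idx_two, idx_three]
  ring

theorem mem_cartan_iff {x : g} : x ∈ cartan ↔ ∃ a b, x = diagLie a b := by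
  rw [cartan, Submodule.mem_span_pair]
  constructor
  · rintro ⟨s, t, rfl⟩
    refine ⟨s - t, -s, ?_⟩
    rw [diagLie, neg_neg, sub_sub_cancel]
  · rintro ⟨a, b, rfl⟩
    exact ⟨_, _, rfl⟩

theorem diagLie_lie (a b : ℂ) (z : Letter) :
    ⁅diagLie a b, z.toLie⁆ = evalWt a b z.wt • z.toLie := by
  refine Subtype.ext ?_
  change (diagLie a b).1 * z.matrix - z.matrix * (diagLie a b).1 = evalWt a b z.wt • z.matrix
  rw [diagLie_coe]
  ext i j
  rw [Matrix.sub_apply, Matrix.diagonal_mul, Matrix.mul_diagonal, Matrix.smul_apply, smul_eq_mul]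
  by_cases h : z.matrix i j = 0
  · simp [h]
  · rw [← z.isGraded i j h, map_sub]
    ring

theorem ι_diagLie_mul_wordU (a b : ℂ) (w : List Letter) :
    UniversalEnvelopingAlgebra.ι ℂ (diagLie a b) * wordU w -
      wordU w * UniversalEnvelopingAlgebra.ι ℂ (diagLie a b) = evalWt a b (wtW w) • wordU w := by
  induction w with
  | nil => simp
  | cons x w ih =>
    have h := LieHom.map_lie (UniversalEnvelopingAlgebra.ι ℂ) (diagLie a b) x.toLie
    rw [diagLie_lie, map_smul, LieRing.of_associative_ring_bracket, eq_sub_iff_add_eq] at h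
    rw [sub_eq_iff_eq_add] at ih
    rw [wordU_cons, ← mul_assoc, ← h, add_mul, mul_assoc, ih, wtW_cons, map_add, add_smul, mul_add,
      mul_assoc, smul_mul_assoc, mul_smul_comm]
    abel

theorem mem_U₀_iff {u : U} : u ∈ U₀ ↔ ∀ a b,
    UniversalEnvelopingAlgebra.ι ℂ (diagLie a b) * u =
      u * UniversalEnvelopingAlgebra.ι ℂ (diagLie a b) := by
  rw [U₀, Subalgebra.mem_centralizer_iff]
  constructor
  · exact fun h a b => h _ ⟨_, mem_cartan_iff.2 ⟨a, b, rfl⟩, rfl⟩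
  · rintro h _ ⟨x, hx, rfl⟩
    obtain ⟨a, b, rfl⟩ := mem_cartan_iff.1 hx
    exact h a b

theorem wordU_mem_U₀ {w : List Letter} (hw : wtW w = 0) : wordU w ∈ U₀ := by
  refine mem_U₀_iff.2 fun a b => sub_eq_zero.1 ?_
  rw [ι_diagLie_mul_wordU, hw, map_zero, zero_smul]

/-- Since 1 and i are independent over ℤ, the single element diag(1, i, -1, -i) separates all
weights. -/
theorem evalWt_injective : Function.Injective (evalWt 1 Complex.I) := by
  intro l m h
  simp only [evalWt_apply, mul_one] at h
  have h₁ := congrArg Complex.re h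
  have h₂ := congrArg Complex.im h
  simp at h₁ h₂
  exact Prod.ext h₁ h₂

/-- Weight spaces lie in eigenspaces of ad h for distinct eigenvalues. The nonzero-weight part of u
lies in the zero eigenspace and in the sum of the others, hence vanishes. -/
theorem mem_span_of_mem_U₀ {u : U} (hu : u ∈ U₀) :
    u ∈ Submodule.span ℂ (wordU '' {w | wtW w = 0}) := by
  let h : U := UniversalEnvelopingAlgebra.ι ℂ (diagLie 1 Complex.I)
  let ad : Module.End ℂ U := LinearMap.mulLeft ℂ h - LinearMap.mulRight ℂ h
  let V : ℤ × ℤ → Submodule ℂ U := fun l => ad.eigenspace (evalWt 1 Complex.I l)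
  have hV : iSupIndep V := ad.eigenspaces_iSupIndep.comp evalWt_injective
  let W : ℤ × ℤ → Submodule ℂ U := fun l => Submodule.span ℂ (wordU '' {w | wtW w = l})
  have hWV : ∀ l, W l ≤ V l := by
    intro l
    refine Submodule.span_le.2 ?_
    rintro _ ⟨w, hw, rfl⟩
    refine Module.End.mem_eigenspace_iff.2 ?_
    rw [← Set.mem_ofPred.1 hw]
    exact ι_diagLie_mul_wordU _ _ _
  have hW : u ∈ ⨆ l, W l := by
    have : (⊤ : Submodule ℂ U) ≤ ⨆ l, W l := by
      rw [← span_wordU]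
      refine Submodule.span_le.2 ?_
      rintro _ ⟨w, rfl⟩
      exact Submodule.mem_iSup_of_mem (wtW w) (Submodule.subset_span ⟨w, rfl, rfl⟩)
    exact this trivial
  obtain ⟨f, hf, rfl⟩ := (Submodule.mem_iSup_iff_exists_finsupp _ _).1 hW
  have hsum : (f.sum fun _ x => x) = f 0 + ∑ l ∈ f.support.erase 0, f l := by
    by_cases h0 : 0 ∈ f.support
    · rw [Finset.add_sum_erase _ _ h0]; rfl
    · rw [Finset.erase_eq_of_notMem h0, Finsupp.notMem_support_iff.1 h0, zero_add]; rfl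
  have h₁ : ∑ l ∈ f.support.erase 0, f l ∈ V 0 := by
    have : (f.sum fun _ x => x) ∈ V 0 := by
      refine Module.End.mem_eigenspace_iff.2 ?_
      rw [map_zero, zero_smul]
      exact sub_eq_zero.2 (mem_U₀_iff.1 hu _ _)
    rw [hsum] at this
    exact (Submodule.add_mem_iff_right _ (hWV 0 (hf 0))).1 this
  have h₂ : ∑ l ∈ f.support.erase 0, f l ∈ ⨆ l, ⨆ _ : l ≠ 0, V l :=
    sum_mem fun l hl => Submodule.mem_iSup_of_mem l
      (Submodule.mem_iSup_of_mem (Finset.ne_of_mem_erase hl) (hWV l (hf l)))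
  rw [hsum, Submodule.disjoint_def.1 (hV 0) _ h₁ h₂, add_zero]
  exact hf 0

/-! ### Expansions and sorted words. -/

/-- The expansion of a word in the Chevalley basis. -/
abbrev expand (w : List Gen) : List Letter := w.flatMap letters

theorem expand_cons (x : Gen) (w : List Gen) : expand (x :: w) = letters x ++ expand w := rfl

theorem expand_append (v w : List Gen) : expand (v ++ w) = expand v ++ expand w :=
  List.flatMap_append

theorem expand_perm {v w : List Gen} (h : v.Perm w) : (expand v).Perm (expand w) :=
  h.flatMap_right _

theorem ofWord_cons (x : Gen) (w : List Gen) :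
    ofWord (x :: w) = FreeAlgebra.ι ℂ x * ofWord w := rfl

theorem ofWord_append (v w : List Gen) : ofWord (v ++ w) = ofWord v * ofWord w := by
  simp [ofWord]

theorem ω_ofWord (w : List Gen) : ω (ofWord w) = wordU (expand w) := by
  induction w with
  | nil => simp [ofWord]
  | cons x w ih =>
    rw [ofWord_cons, map_mul, ih, expand_cons, wordU_append, ω, FreeAlgebra.lift_ι_apply,
      perfect_eq]

theorem wtW_letters (x : Gen) : wtW (letters x) = 0 := by
  revert x; decide

theorem wtW_expand (w : List Gen) : wtW (expand w) = 0 := by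
  induction w with
  | nil => rfl
  | cons x w ih => rw [expand_cons, wtW_append, wtW_letters, ih, add_zero]

theorem count_expand (w : List Gen) (y : Letter) :
    (expand w).count y = ∑ x : Gen, w.count x * (letters x).count y := by
  induction w with
  | nil => simp
  | cons z w ih =>
    rw [expand_cons, List.count_append, ih]
    simp [List.count_cons, add_mul, Finset.sum_add_distrib, add_comm]

/-- The word `h₁^s(h₁) h₂^s(h₂) c₁^s(c₁) ⋯ c₁₂^s(c₁₂)`. -/
def sortedWord (s : Gen → ℕ) : List Gen :=
  (List.ofFn fun x : Gen => List.replicate (s x) x).flatten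

theorem count_sortedWord (s : Gen → ℕ) (x : Gen) : (sortedWord s).count x = s x := by
  rw [sortedWord, List.count_flatten, List.map_ofFn, List.sum_ofFn]
  simp [List.count_replicate]

theorem pairwise_sortedWord (s : Gen → ℕ) : (sortedWord s).Pairwise (· ≤ ·) := by
  rw [sortedWord, List.pairwise_flatten]
  constructor
  · intro l hl
    obtain ⟨x, rfl⟩ := (List.mem_ofFn' _ _).1 hl
    exact List.pairwise_replicate.2 (Or.inr le_rfl)
  · rw [List.pairwise_ofFn]
    intro i j hij x hx y hy
    rw [List.eq_of_mem_replicate hx, List.eq_of_mem_replicate hy]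
    exact hij.le

theorem eq_sortedWord_of_pairwise {w : List Gen} (h : w.Pairwise (· ≤ ·)) :
    w = sortedWord fun x => w.count x :=
  List.Perm.eq_of_pairwise (fun _ _ _ _ => le_antisymm) h (pairwise_sortedWord _)
    (List.perm_iff_count.2 fun x => (count_sortedWord (fun x => w.count x) x).symm)

theorem monomial_eq (s : Gen → ℕ) : monomial s = wordU (expand (sortedWord s)) := by
  rw [← ω_ofWord, monomial, sortedWord, ofWord, List.map_flatten, List.prod_flatten, map_list_prod]
  simp only [List.map_ofFn]
  congr 2
  funext x
  simp [ω]

/-! ### Reduced exponent vectors and weight-zero multisets. -/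

/-- Counts of letters in the expansion, in terms of the exponents. -/
def CountsOf (s : Gen → ℕ) (c : Letter → ℕ) : Prop :=
  c .h01 = s 0 ∧ c .h10 = s 1 ∧
  c .f01 = s 2 + s 7 + s 11 + s 12 ∧ c .e01 = s 2 + s 6 + s 10 + s 13 ∧
  c .f21 = s 3 + s 8 + s 10 + s 12 ∧ c .e21 = s 3 + s 9 + s 11 + s 13 ∧
  c .f10 = s 4 + s 7 + s 9 + 2 * s 11 ∧ c .e10 = s 4 + s 6 + s 8 + 2 * s 10 ∧
  c .f11 = s 5 + s 6 + s 9 + 2 * s 13 ∧ c .e11 = s 5 + s 7 + s 8 + 2 * s 12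

theorem countsOf_expand (w : List Gen) :
    CountsOf (fun x => w.count x) (fun y => (expand w).count y) := by
  simp only [CountsOf, count_expand, Fin.sum_univ_succ]
  simp [letters]
  omega

/-- No root vector of `c₅, …, c₁₂` occurs together with the opposite one. -/
def Reduced (s : Gen → ℕ) : Prop :=
  (s 6 + s 10 + s 13 = 0 ∨ s 7 + s 11 + s 12 = 0) ∧
  (s 9 + s 11 + s 13 = 0 ∨ s 8 + s 10 + s 12 = 0) ∧
  (s 6 + s 8 + s 10 = 0 ∨ s 7 + s 9 + s 11 = 0) ∧
  (s 7 + s 8 + s 12 = 0 ∨ s 6 + s 9 + s 13 = 0)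

/-- Each condition picks a sign for one root; whichever of the sixteen choices is made, the
surviving symbols among c₅, …, c₁₂ lie in one of the eight pairs. -/
theorem reduced_iff (s : Gen → ℕ) : Reduced s ↔ ∃ p ∈ pairs, ∀ k : Fin 12,
    5 ≤ (k : ℕ) + 1 → (k : ℕ) + 1 ≠ p.1 → (k : ℕ) + 1 ≠ p.2 → s (cGen k) = 0 := by
  have h : ∀ k : Fin 12, s (cGen k) = ![s 2, s 3, s 4, s 5, s 6, s 7, s 8, s 9, s 10, s 11,
      s 12, s 13] k := by
    intro k; fin_cases k <;> rfl
  simp only [h, pairs, Fin.forall_fin_succ, Reduced, List.mem_cons, List.not_mem_nil, or_false,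
    exists_eq_or_imp, exists_eq_left, Nat.add_eq_zero_iff]
  simp
  constructor
  · rintro ⟨⟨⟨_, _⟩, _⟩ | ⟨⟨_, _⟩, _⟩, ⟨⟨_, _⟩, _⟩ | ⟨⟨_, _⟩, _⟩, ⟨⟨_, _⟩, _⟩ | ⟨⟨_, _⟩, _⟩,
      ⟨⟨_, _⟩, _⟩ | ⟨⟨_, _⟩, _⟩⟩ <;> simp only [*, true_and, and_true, true_or, or_true]
  · rintro (h | h | h | h | h | h | h | h) <;> simp [h]

/-- The exponents of the reduced monomial with given counts of letters. -/
def coneExp (c : Letter → ℕ) : Gen → ℕ :=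
  ![c .h01, c .h10, min (c .e01) (c .f01), min (c .e21) (c .f21), min (c .e10) (c .f10),
    min (c .e11) (c .f11),
    min (c .e10 - c .f10) (c .f11 - c .e11), min (c .f10 - c .e10) (c .e11 - c .f11),
    min (c .e10 - c .f10) (c .e11 - c .f11), min (c .f10 - c .e10) (c .f11 - c .e11),
    min (c .e01 - c .f01) (c .f21 - c .e21), min (c .f01 - c .e01) (c .e21 - c .f21),
    min (c .f01 - c .e01) (c .f21 - c .e21), min (c .e01 - c .f01) (c .e21 - c .f21)]

/-- Opposite root vectors meet only in c₁, …, c₄, whose exponents are therefore minima of opposite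
counts. The excesses go to c₅, …, c₁₂: each exponent is the smaller of two excesses, of the short
roots for c₅, …, c₈ and of the long roots for c₉, …, c₁₂. -/
theorem CountsOf.eq_coneExp {s : Gen → ℕ} {c : Letter → ℕ} (hs : CountsOf s c)
    (rs : Reduced s) : s = coneExp c := by
  obtain ⟨g1, g2, g3, g4, g5, g6, g7, g8, g9, g10⟩ := hs
  simp only [Reduced, Nat.add_eq_zero_iff] at rs
  have key : s 6 = min (c .e10 - c .f10) (c .f11 - c .e11) ∧
      s 7 = min (c .f10 - c .e10) (c .e11 - c .f11) ∧
      s 8 = min (c .e10 - c .f10) (c .e11 - c .f11) ∧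
      s 9 = min (c .f10 - c .e10) (c .f11 - c .e11) ∧
      s 10 = min (c .e01 - c .f01) (c .f21 - c .e21) ∧
      s 11 = min (c .f01 - c .e01) (c .e21 - c .f21) ∧
      s 12 = min (c .f01 - c .e01) (c .f21 - c .e21) ∧
      s 13 = min (c .e01 - c .f01) (c .e21 - c .f21) ∧
      s 2 = min (c .e01) (c .f01) ∧ s 3 = min (c .e21) (c .f21) ∧
      s 4 = min (c .e10) (c .f10) ∧ s 5 = min (c .e11) (c .f11) := by
    rw [g3, g4, g5, g6, g7, g8, g9, g10]
    clear g1 g2 g3 g4 g5 g6 g7 g8 g9 g10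
    rcases rs with ⟨⟨⟨z1, z2⟩, z3⟩ | ⟨⟨z1, z2⟩, z3⟩, ⟨⟨z4, z5⟩, z6⟩ | ⟨⟨z4, z5⟩, z6⟩,
      ⟨⟨z7, z8⟩, z9⟩ | ⟨⟨z7, z8⟩, z9⟩, ⟨⟨z10, z11⟩, z12⟩ | ⟨⟨z10, z11⟩, z12⟩⟩ <;>
      simp [z1, z2, z3, z4, z5, z6, z7, z8, z9, z10, z11, z12, add_assoc]
  obtain ⟨k6, k7, k8, k9, k10, k11, k12, k13, k2, k3, k4, k5⟩ := key
  funext x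
  fin_cases x
  exacts [g1.symm, g2.symm, k2, k3, k4, k5, k6, k7, k8, k9, k10, k11, k12, k13]

/-- The hypotheses say that the coefficients of α₁ and α₂ in the weight vanish. The check splits on
the signs of the four excesses. -/
theorem exists_countsOf (c : Letter → ℕ)
    (h₁ : c .e10 + c .e11 + 2 * c .e21 = c .f10 + c .f11 + 2 * c .f21)
    (h₂ : c .e01 + c .e11 + c .e21 = c .f01 + c .f11 + c .f21) :
    ∃ s, Reduced s ∧ CountsOf s c := by
  refine ⟨coneExp c, ?_⟩
  simp only [Reduced, CountsOf, coneExp]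
  simp
  generalize c .e10 = e10 at *
  generalize c .e11 = e11 at *
  generalize c .e21 = e21 at *
  generalize c .e01 = e01 at *
  generalize c .f10 = f10 at *
  generalize c .f11 = f11 at *
  generalize c .f21 = f21 at *
  generalize c .f01 = f01 at *
  rcases le_total e01 f01 with a1 | a1 <;> rcases le_total e21 f21 with a2 | a2 <;>
    rcases le_total e10 f10 with a3 | a3 <;> rcases le_total e11 f11 with a4 | a4 <;>
    obtain ⟨d1, rfl⟩ := Nat.exists_eq_add_of_le a1 <;>
    obtain ⟨d2, rfl⟩ := Nat.exists_eq_add_of_le a2 <;>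
    obtain ⟨d3, rfl⟩ := Nat.exists_eq_add_of_le a3 <;>
    obtain ⟨d4, rfl⟩ := Nat.exists_eq_add_of_le a4 <;>
    simp <;> omega

theorem count_eq_of_wtW_eq_zero {u : List Letter} (hu : wtW u = 0) :
    u.count .e10 + u.count .e11 + 2 * u.count .e21 =
      u.count .f10 + u.count .f11 + 2 * u.count .f21 ∧
    u.count .e01 + u.count .e11 + u.count .e21 = u.count .f01 + u.count .f11 + u.count .f21 := by
  have h : wtW u = ∑ z : Letter, u.count z • z.wt := by
    rw [wtW, Finset.sum_list_map_count]
    exact Finset.sum_subset (Finset.subset_univ _) fun z _ hz => by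
      rw [List.count_eq_zero_of_not_mem (by simpa using hz), zero_smul]
  rw [hu, sum_letter] at h
  have h₁ := congrArg Prod.fst h
  have h₂ := congrArg Prod.snd h
  simp [Letter.wt] at h₁ h₂
  omega

theorem perm_of_countsOf {u v : List Letter} {s : Gen → ℕ} (hu : CountsOf s fun y => u.count y)
    (hv : CountsOf s fun y => v.count y) : u.Perm v := by
  refine List.perm_iff_count.2 fun y => ?_
  simp only [CountsOf] at hu hv
  cases y <;> omega

theorem countsOf_sortedWord (s : Gen → ℕ) :
    CountsOf s fun y => (expand (sortedWord s)).count y := by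
  have h := countsOf_expand (sortedWord s)
  simpa only [count_sortedWord] using h

theorem exists_reduced_perm {u : List Letter} (hu : wtW u = 0) :
    ∃ s, Reduced s ∧ (expand (sortedWord s)).Perm u := by
  obtain ⟨s, hs, hc⟩ := exists_countsOf (fun y => u.count y) (count_eq_of_wtW_eq_zero hu).1
    (count_eq_of_wtW_eq_zero hu).2
  exact ⟨s, hs, perm_of_countsOf (countsOf_sortedWord s) hc⟩

theorem Reduced.eq_of_perm {s t : Gen → ℕ} (rs : Reduced s) (rt : Reduced t)
    (h : (expand (sortedWord s)).Perm (expand (sortedWord t))) : s = t := by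
  rw [(countsOf_sortedWord s).eq_coneExp rs, (countsOf_sortedWord t).eq_coneExp rt]
  simp only [h.count_eq]

/-- The positive root vectors. -/
def posLetter : Fin 4 → Letter := ![.e01, .e21, .e10, .e11]

/-- The negative root vectors. -/
def negLetter : Fin 4 → Letter := ![.f01, .f21, .f10, .f11]

/-- The names of `c₁, …, c₄`. -/
def rootGen (k : Fin 4) : Gen := Fin.castAdd 8 (Fin.natAdd 2 k)

theorem letters_rootGen (k : Fin 4) : letters (rootGen k) = [negLetter k, posLetter k] := by
  revert k; decide

/-- Index 6 is c₅, since 0 and 1 are h₁, h₂ and 2, …, 5 are c₁, …, c₄. -/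
theorem reduced_of_forall {w : List Gen}
    (h : ∀ k i j, 6 ≤ i → 6 ≤ j → i ∈ w → j ∈ w → posLetter k ∈ letters i →
      negLetter k ∈ letters j → False) : Reduced fun x => w.count x := by
  have h' : ∀ k i j, 6 ≤ i → 6 ≤ j → posLetter k ∈ letters i → negLetter k ∈ letters j →
      w.count i = 0 ∨ w.count j = 0 := by
    intro k i j hi hj hik hjk
    by_contra! hne
    exact h k i j hi hj (by simpa [List.count_eq_zero] using hne.1)
      (by simpa [List.count_eq_zero] using hne.2) hik hjk
  simp only [Reduced, Nat.add_eq_zero_iff]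
  refine ⟨?_, ?_, ?_, ?_⟩
  · have h0 := h' 0
    simp [Fin.forall_fin_succ, posLetter, negLetter, letters] at h0
    grind
  · have h1 := h' 1
    simp [Fin.forall_fin_succ, posLetter, negLetter, letters] at h1
    grind
  · have h2 := h' 2
    simp [Fin.forall_fin_succ, posLetter, negLetter, letters] at h2
    grind
  · have h3 := h' 3
    simp [Fin.forall_fin_succ, posLetter, negLetter, letters] at h3
    grind

/-! ### Semi-perfect words are the sorted reduced words. -/

theorem letters_length_pos (x : Gen) : 0 < (letters x).length := by
  revert x; decide

theorem length_le_length_expand (w : List Gen) : w.length ≤ (expand w).length := by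
  induction w with
  | nil => simp
  | cons x w ih =>
    have := letters_length_pos x
    rw [expand_cons, List.length_append, List.length_cons]
    omega

theorem finite_T₁ (w : List Gen) : (T₁ w).Finite :=
  (List.finite_length_le Gen (expand w).length).subset fun v hv =>
    (length_le_length_expand v).trans (List.Perm.length_eq hv).le

theorem exists_semiPerfect_perm (w : List Gen) :
    ∃ v, SemiPerfect v ∧ (expand v).Perm (expand w) := by
  obtain ⟨v, hv, hmin⟩ := Set.exists_min_image (T₁ w) id (finite_T₁ w) ⟨w, List.Perm.refl _⟩
  exact ⟨v, ⟨List.Perm.refl _, fun u hu => hmin u (List.Perm.trans hu hv)⟩, hv⟩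

theorem SemiPerfect.eq_of_perm {v w : List Gen} (hv : SemiPerfect v) (hw : SemiPerfect w)
    (h : (expand v).Perm (expand w)) : v = w :=
  le_antisymm (hv.2 (List.Perm.symm h)) (hw.2 h)

theorem append_cons_lt {x y : Gen} (h : x < y) (u v w : List Gen) :
    u ++ x :: v < u ++ y :: w := by
  induction u with
  | nil => exact List.Lex.rel h
  | cons z u ih => exact List.Lex.cons ih

/-- The minimality criterion in use: no tail of a semi-perfect word can be regrouped so as to start
with a smaller symbol. -/
theorem SemiPerfect.not_perm {x y : Gen} (hxy : x < y) {u v w : List Gen}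
    (h : SemiPerfect (u ++ y :: w)) : ¬ (expand (x :: v)).Perm (expand (y :: w)) := by
  intro hp
  refine (append_cons_lt hxy u v w).not_ge (h.2 ?_)
  change (expand _).Perm (expand _)
  rw [expand_append, expand_append]
  exact hp.append_left _

theorem SemiPerfect.pairwise {w : List Gen} (h : SemiPerfect w) : w.Pairwise (· ≤ ·) := by
  rw [← List.isChain_iff_pairwise, List.isChain_iff_forall_rel_of_append_cons_cons]
  rintro a b l₁ l₂ rfl
  by_contra! hba
  exact h.not_perm hba (expand_perm (List.Perm.swap a b l₂))

/-- A word that contains a root vector and its opposite may be regrouped so as to begin with the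
corresponding `c_k`. -/
theorem exists_perm_rootGen_cons {u : List Letter} (hu : wtW u = 0) {k : Fin 4}
    (hp : posLetter k ∈ u) (hn : negLetter k ∈ u) :
    ∃ v, (expand (rootGen k :: v)).Perm u := by
  have hne : posLetter k ≠ negLetter k := by clear hp hn; revert k; decide
  have hn' : negLetter k ∈ u.erase (posLetter k) := (List.mem_erase_of_ne hne.symm).2 hn
  have h : ([negLetter k, posLetter k] ++ (u.erase (posLetter k)).erase (negLetter k)).Perm u :=
    (List.Perm.swap _ _ _).trans
      (((List.perm_cons_erase hn').symm.cons _).trans (List.perm_cons_erase hp).symm)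
  -- Without the opposite pair the rest still has weight zero, so it can be regrouped into perfect
  -- monomials.
  have h0 : wtW ((u.erase (posLetter k)).erase (negLetter k)) = 0 := by
    have := wtW_perm h
    rw [hu, wtW_append, ← letters_rootGen, wtW_letters, zero_add] at this
    exact this
  obtain ⟨s, -, hs⟩ := exists_reduced_perm h0
  refine ⟨sortedWord s, ?_⟩
  rw [expand_cons, letters_rootGen]
  exact (hs.append_left _).trans h

theorem rootGen_lt (k : Fin 4) : rootGen k < 6 := by
  revert k; decide

theorem SemiPerfect.reduced {w : List Gen} (h : SemiPerfect w) :
    Reduced fun x => w.count x := by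
  refine reduced_of_forall fun k i j hi hj hiw hjw hik hjk => ?_
  have hk := rootGen_lt k
  -- Cut off the initial symbols up to c_k. The tail still contains both opposite root vectors and
  -- starts above c_k, so regrouping it to start with c_k contradicts minimality.
  set A := w.takeWhile (· ≤ rootGen k)
  set B := w.dropWhile (· ≤ rootGen k) with hB
  have hw : w = A ++ B := List.takeWhile_append_dropWhile.symm
  have hmem : ∀ i, 6 ≤ i → i ∈ w → i ∈ B := by
    intro i hi hiw
    rw [hw, List.mem_append] at hiw
    refine hiw.resolve_left fun hiA => ?_
    have := List.mem_takeWhile_imp hiA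
    simp only [decide_eq_true_eq] at this
    exact absurd (hi.trans this) (not_le.2 hk)
  obtain ⟨v, hv⟩ := exists_perm_rootGen_cons (wtW_expand B)
    (List.mem_flatMap.2 ⟨i, hmem i hi hiw, hik⟩) (List.mem_flatMap.2 ⟨j, hmem j hj hjw, hjk⟩)
  obtain ⟨y, B', hyB⟩ := List.exists_cons_of_ne_nil (List.ne_nil_of_mem (hmem i hi hiw))
  have hy : rootGen k < y := by
    have h0 : B ≠ [] := by rw [hyB]; exact List.cons_ne_nil _ _
    have := List.head_dropWhile_not (· ≤ rootGen k) (l := w) h0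
    simp only [← hB, hyB, List.head_cons, decide_eq_false_iff_not, not_le] at this
    exact this
  rw [hyB] at hw hv
  rw [hw] at h
  exact h.not_perm hy hv

theorem SemiPerfect.eq_sortedWord {w : List Gen} (h : SemiPerfect w) :
    w = sortedWord fun x => w.count x :=
  eq_sortedWord_of_pairwise h.pairwise

/-- The minimal word of the class is itself sorted and reduced, and a class has only one such word.
-/
theorem Reduced.semiPerfect {s : Gen → ℕ} (hs : Reduced s) : SemiPerfect (sortedWord s) := by
  obtain ⟨v, hv, hvs⟩ := exists_semiPerfect_perm (sortedWord s)
  have hv' := hv.eq_sortedWord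
  rw [hv'] at hvs
  rw [← hv.reduced.eq_of_perm hs hvs, ← hv']
  exact hv

theorem exists_semiPerfect_of_wtW {u : List Letter} (hu : wtW u = 0) :
    ∃ w, SemiPerfect w ∧ (expand w).Perm u := by
  obtain ⟨s, hs, h⟩ := exists_reduced_perm hu
  exact ⟨_, hs.semiPerfect, h⟩

/-! ### The basis of U₀ and the normal forms. -/

/-- The span of the values of the semi-perfect words of bounded degree. -/
def spSpan (n : ℕ) : Submodule ℂ U :=
  Submodule.span ℂ ((fun w => wordU (expand w)) '' {w | SemiPerfect w ∧ (expand w).length < n})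

theorem spSpan_mono {m n : ℕ} (h : m ≤ n) : spSpan m ≤ spSpan n :=
  Submodule.span_mono (Set.image_mono fun _ hw => ⟨hw.1, hw.2.trans_le h⟩)

/-- Rearranging a weight-zero word into the semi-perfect word of its class costs only shorter
weight-zero words, handled by induction. -/
theorem wordSpan_zero_le (n : ℕ) : wordSpan 0 n ≤ spSpan n := by
  induction n with
  | zero =>
    refine Submodule.span_le.2 ?_
    rintro _ ⟨u, ⟨-, hn⟩, rfl⟩
    exact absurd hn (Nat.not_lt_zero _)
  | succ n ih =>
    refine Submodule.span_le.2 ?_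
    rintro _ ⟨u, ⟨hu, hn⟩, rfl⟩
    obtain ⟨w, hw, hwu⟩ := exists_semiPerfect_of_wtW hu
    have h₁ : wordU (expand w) ∈ spSpan (n + 1) :=
      Submodule.subset_span ⟨w, ⟨hw, hwu.length_eq ▸ hn⟩, rfl⟩
    have h₂ := wordU_sub_mem_wordSpan hwu.symm
    rw [hu] at h₂
    have h₃ : wordSpan 0 u.length ≤ wordSpan 0 n :=
      Submodule.span_mono (Set.image_mono fun _ hw => ⟨hw.1, hw.2.trans_le (by omega)⟩)
    have h₄ := spSpan_mono (Nat.le_succ n) (ih (h₃ h₂))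
    rw [← sub_add_cancel (wordU u) (wordU (expand w))]
    exact add_mem h₄ h₁

theorem span_semiPerfect :
    Submodule.span ℂ ((fun w => wordU (expand w)) '' {w | SemiPerfect w}) =
      Subalgebra.toSubmodule U₀ := by
  refine le_antisymm (Submodule.span_le.2 ?_) fun u hu => ?_
  · rintro _ ⟨w, -, rfl⟩
    exact wordU_mem_U₀ (wtW_expand w)
  · refine Submodule.span_le.2 ?_ (mem_span_of_mem_U₀ hu)
    rintro _ ⟨v, hv, rfl⟩
    have h := wordSpan_zero_le (v.length + 1) (wordU_mem_wordSpan hv (Nat.lt_succ_self _))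
    exact Submodule.span_mono (Set.image_mono fun _ hw => hw.1) h

theorem linearIndependent_monomial :
    LinearIndependent ℂ fun s : Exponents => monomial s.val := by
  simp only [monomial_eq]
  refine linearIndependent_wordU _ fun s t h => Subtype.ext ?_
  exact ((reduced_iff _).2 s.2).eq_of_perm ((reduced_iff _).2 t.2) h

theorem span_monomial : Submodule.span ℂ (Set.range fun s : Exponents => monomial s.val) =
    Subalgebra.toSubmodule U₀ := by
  rw [← span_semiPerfect]
  congr 1
  ext u
  constructor
  · rintro ⟨s, rfl⟩
    exact ⟨_, ((reduced_iff _).2 s.2).semiPerfect, (monomial_eq _).symm⟩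
  · rintro ⟨w, hw, rfl⟩
    refine ⟨⟨_, (reduced_iff _).1 hw.reduced⟩, ?_⟩
    change monomial _ = _
    rw [monomial_eq, ← hw.eq_sortedWord]

theorem ω_mem_U₀ (x : Free) : ω x ∈ U₀ := by
  induction x using FreeAlgebra.induction with
  | grade0 r => rw [AlgHom.commutes]; exact U₀.algebraMap_mem r
  | grade1 x =>
    rw [ω, FreeAlgebra.lift_ι_apply, perfect_eq]
    exact wordU_mem_U₀ (wtW_letters x)
  | mul a b ha hb => rw [map_mul]; exact mul_mem ha hb
  | add a b ha hb => rw [map_add]; exact add_mem ha hb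

theorem map_span_ofWord (S : Set (List Gen)) :
    (Submodule.span ℂ (ofWord '' S)).map ω.toLinearMap =
      Submodule.span ℂ ((fun w => wordU (expand w)) '' S) := by
  rw [Submodule.map_span, ← Set.image_comp]
  congr 2
  funext w
  exact ω_ofWord w

/-- Distinct semi-perfect words have distinct letter multisets, so their values are independent. -/
theorem eq_zero_of_ω_eq_zero {n : Free}
    (hn : n ∈ Submodule.span ℂ (ofWord '' {w | SemiPerfect w})) (h : ω n = 0) : n = 0 := by
  rw [Finsupp.mem_span_image_iff_linearCombination] at hn
  obtain ⟨l, hl, rfl⟩ := hn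
  have hli : LinearIndepOn ℂ (fun w => wordU (expand w)) {w | SemiPerfect w} :=
    linearIndependent_wordU _ fun v w hvw => Subtype.ext (v.2.eq_of_perm w.2 hvw)
  have h0 : Finsupp.linearCombination ℂ (fun w => wordU (expand w)) l = 0 := by
    rw [← h, Finsupp.linearCombination_apply, Finsupp.linearCombination_apply, map_finsuppSum]
    simp only [map_smul, ω_ofWord]
  rw [linearIndepOn_iff.1 hli l hl h0, map_zero]

theorem existsUnique_isNormalForm (x : Free) : ∃! n, IsNormalForm x n := by
  have hx : ω x ∈ (Submodule.span ℂ (ofWord '' {w | SemiPerfect w})).map ω.toLinearMap := by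
    rw [map_span_ofWord, span_semiPerfect]
    exact ω_mem_U₀ x
  obtain ⟨n, hn, hnx⟩ := hx
  refine ⟨n, ⟨hn, hnx⟩, fun m hm => sub_eq_zero.1 (eq_zero_of_ω_eq_zero (sub_mem hm.1 hn) ?_)⟩
  rw [map_sub, hm.2, sub_eq_zero]
  exact hnx.symm

/-! ### Generation of the ideal of relations. -/

/-- The ideal generated by the relations of length two and by centrality of `h₁, h₂`. -/
def relIdeal : TwoSidedIdeal Free := TwoSidedIdeal.span (centralityRelations ∪ relationsOfLength 2)

/-- The ideal `relIdeal` as a subspace. -/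
def relSub : Submodule ℂ Free where
  carrier := relIdeal
  add_mem' := relIdeal.add_mem
  zero_mem' := relIdeal.zero_mem
  smul_mem' c x hx := by
    rw [Algebra.smul_def]
    exact relIdeal.mul_mem_left _ _ hx

theorem mem_relSub {x : Free} : x ∈ relSub ↔ x ∈ relIdeal := Iff.rfl

theorem relIdeal_le : relIdeal ≤ K := by
  refine TwoSidedIdeal.span_le.2 ?_
  rintro _ (⟨i, x, rfl⟩ | ⟨w, n, -, hn, rfl⟩)
  · refine (TwoSidedIdeal.mem_ker _).2 ?_
    rw [map_sub, map_mul, map_mul, sub_eq_zero, eq_comm]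
    have hx : ω (FreeAlgebra.ι ℂ x) ∈ U₀ := ω_mem_U₀ _
    refine Subalgebra.mem_centralizer_iff ℂ |>.1 hx _ ?_
    rw [ω, FreeAlgebra.lift_ι_apply]
    fin_cases i
    · exact ⟨Letter.h01.toLie, Submodule.subset_span (by simp), (mul_one _).symm⟩
    · exact ⟨Letter.h10.toLie, Submodule.subset_span (by simp), (mul_one _).symm⟩
  · refine (TwoSidedIdeal.mem_ker _).2 ?_
    rw [map_sub, hn.2, sub_self]

/-- The span of the words whose expansion has bounded length. -/
def lowSpan (d : ℕ) : Submodule ℂ Free :=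
  Submodule.span ℂ (ofWord '' {w | (expand w).length < d})

/-- Two words of the same class agree modulo the relations and words of lower degree. -/
def WordCongr (v w : List Gen) : Prop :=
  (expand v).Perm (expand w) ∧ ofWord v - ofWord w ∈ relSub ⊔ lowSpan (expand v).length

theorem WordCongr.refl (v : List Gen) : WordCongr v v :=
  ⟨List.Perm.refl _, by simp⟩

theorem WordCongr.symm {v w : List Gen} (h : WordCongr v w) : WordCongr w v :=
  ⟨h.1.symm, by rw [← neg_sub, ← h.1.length_eq]; exact neg_mem h.2⟩

theorem WordCongr.trans {u v w : List Gen} (h₁ : WordCongr u v) (h₂ : WordCongr v w) :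
    WordCongr u w := by
  refine ⟨h₁.1.trans h₂.1, ?_⟩
  have := h₂.2
  rw [← h₁.1.length_eq] at this
  simpa using add_mem h₁.2 this

theorem WordCongr.append {u v : List Gen} (h : WordCongr u v) (a b : List Gen) :
    WordCongr (a ++ u ++ b) (a ++ v ++ b) := by
  refine ⟨?_, ?_⟩
  · simp only [expand_append]
    exact (h.1.append_left _).append_right _
  · let f : Free →ₗ[ℂ] Free :=
      (LinearMap.mulRight ℂ (ofWord b)).comp (LinearMap.mulLeft ℂ (ofWord a))
    have hf : relSub ⊔ lowSpan (expand u).length ≤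
        (relSub ⊔ lowSpan (expand (a ++ u ++ b)).length).comap f := by
      refine sup_le (fun x hx => ?_) (Submodule.span_le.2 ?_)
      · exact Submodule.mem_sup_left
          (relIdeal.mul_mem_right _ _ (relIdeal.mul_mem_left _ _ hx))
      · rintro _ ⟨w, hw, rfl⟩
        refine Submodule.mem_sup_right (Submodule.subset_span ⟨a ++ w ++ b, ?_, ?_⟩)
        · have : (expand w).length < (expand u).length := hw
          simp only [Set.mem_ofPred_eq, expand_append, List.length_append]
          omega
        · rw [ofWord_append, ofWord_append]; rfl
    have := hf h.2
    simp only [ofWord_append]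
    rw [← sub_mul, ← mul_sub]
    exact this

/-- The normal form of c_i c_j is the semi-perfect word r of its class plus a combination m of
semi-perfect words of lower degree. -/
theorem exists_semiPerfect_wordCongr_pair (i j : Fin 12) :
    ∃ r, SemiPerfect r ∧ WordCongr [cGen i, cGen j] r := by
  obtain ⟨r, hr, hp⟩ := exists_semiPerfect_perm [cGen i, cGen j]
  refine ⟨r, hr, hp.symm, ?_⟩
  have h := wordU_sub_mem_wordSpan hp.symm
  rw [wtW_expand] at h
  have h' := wordSpan_zero_le _ h
  rw [spSpan, ← map_span_ofWord] at h'
  obtain ⟨m, hm, hmω⟩ := h'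
  have hrel : ofWord [cGen i, cGen j] - (ofWord r + m) ∈ relIdeal := by
    refine TwoSidedIdeal.subset_span (Or.inr ⟨[i, j], ofWord r + m, rfl, ⟨?_, ?_⟩, rfl⟩)
    · refine add_mem (Submodule.subset_span ⟨r, hr, rfl⟩) ?_
      exact Submodule.span_mono (Set.image_mono fun _ hw => hw.1) hm
    · have : ω m = _ := hmω
      rw [map_add, this, ω_ofWord, add_sub_cancel]
      exact (ω_ofWord _).symm
  have hlow : m ∈ lowSpan (expand [cGen i, cGen j]).length :=
    Submodule.span_mono (Set.image_mono fun _ hw => hw.2) hm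
  have := Submodule.add_mem_sup (mem_relSub.2 hrel) hlow
  rwa [← sub_sub, sub_add_cancel] at this

theorem wordCongr_swap_hGen (i : Fin 2) (x : Gen) :
    WordCongr [x, hGen i] [hGen i, x] := by
  refine ⟨expand_perm (List.Perm.swap _ _ _), Submodule.mem_sup_left (mem_relSub.2 ?_)⟩
  refine TwoSidedIdeal.subset_span (Or.inl ⟨i, x, ?_⟩)
  simp [ofWord]

theorem gen_cases (x : Gen) : (∃ i, x = hGen i) ∨ ∃ k, x = cGen k :=
  Fin.addCases (m := 2) (n := 12) (motive := fun x => (∃ i, x = hGen i) ∨ ∃ k, x = cGen k)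
    (fun i => Or.inl ⟨i, rfl⟩) (fun k => Or.inr ⟨k, rfl⟩) x

/-- For two c's, both orders reduce to the same semi-perfect word, so no commutator has to be
computed. -/
theorem wordCongr_swap (x y : Gen) : WordCongr [x, y] [y, x] := by
  rcases gen_cases x with ⟨i, rfl⟩ | ⟨i, rfl⟩
  · exact (wordCongr_swap_hGen i y).symm
  rcases gen_cases y with ⟨j, rfl⟩ | ⟨j, rfl⟩
  · exact wordCongr_swap_hGen j _
  obtain ⟨r, hr, h₁⟩ := exists_semiPerfect_wordCongr_pair i j
  obtain ⟨s, hs, h₂⟩ := exists_semiPerfect_wordCongr_pair j i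
  have : r = s := hr.eq_of_perm hs
    (h₁.1.symm.trans ((expand_perm (List.Perm.swap _ _ _)).trans h₂.1))
  subst this
  exact h₁.trans h₂.symm

theorem wordCongr_of_perm {v w : List Gen} (h : v.Perm w) : WordCongr v w := by
  induction h with
  | nil => exact WordCongr.refl _
  | cons x _ ih => simpa using ih.append [x] []
  | swap x y l => exact (wordCongr_swap y x).append [] l
  | trans _ _ ih₁ ih₂ => exact ih₁.trans ih₂

/-- The part of the degree of a word that comes from `c₅, …, c₁₂`. -/
def highDegree (w : List Gen) : ℕ :=
  (w.map fun x => if 6 ≤ x then (letters x).length else 0).sum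

theorem highDegree_cons (x : Gen) (w : List Gen) :
    highDegree (x :: w) = (if 6 ≤ x then (letters x).length else 0) + highDegree w := by
  simp [highDegree]

theorem highDegree_append (v w : List Gen) :
    highDegree (v ++ w) = highDegree v + highDegree w := by
  simp [highDegree]

theorem highDegree_perm {v w : List Gen} (h : v.Perm w) : highDegree v = highDegree w :=
  (h.map _).sum_eq

theorem highDegree_le (w : List Gen) : highDegree w ≤ (expand w).length := by
  induction w with
  | nil => simp [highDegree]
  | cons x w ih =>
    rw [highDegree_cons, expand_cons, List.length_append]
    split_ifs <;> omega

theorem highDegree_lt {w : List Gen} {x : Gen} (hx : x < 6) (hw : x ∈ w) :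
    highDegree w < (expand w).length := by
  have h := List.perm_cons_erase hw
  rw [highDegree_perm h, (expand_perm h).length_eq, highDegree_cons, expand_cons,
    List.length_append, if_neg (not_le.2 hx)]
  have := highDegree_le (w.erase x)
  have := letters_length_pos x
  omega

/-- In a reduced vector the exponent of c_k is the minimum of the two opposite counts. -/
theorem SemiPerfect.rootGen_mem {r : List Gen} (h : SemiPerfect r) {k : Fin 4}
    (hp : posLetter k ∈ expand r) (hn : negLetter k ∈ expand r) : rootGen k ∈ r := by
  have hr := congrFun ((countsOf_expand r).eq_coneExp h.reduced) (rootGen k)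
  rw [← List.count_pos_iff] at hp hn ⊢
  rw [hr]
  fin_cases k <;> exact lt_min hp hn

/-- Bring the two offending symbols together and replace them by the semi-perfect word of their
class: the degree is unchanged, but some of it moves into c_k with k ≤ 4. -/
theorem exists_wordCongr_highDegree_lt {w : List Gen} (hw : ¬ Reduced fun x => w.count x) :
    ∃ v, WordCongr w v ∧ highDegree v < highDegree w := by
  by_contra! hno
  refine hw (reduced_of_forall fun k i j hi hj hiw hjw hik hjk => ?_)
  -- No single perfect monomial among c₅, …, c₁₂ contains opposite root vectors.
  have hij : i ≠ j := by
    rintro rfl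
    have : ∀ (k : Fin 4) (i : Gen), 6 ≤ i → posLetter k ∈ letters i →
      negLetter k ∉ letters i := by decide
    exact this k i hi hik hjk
  have hp : w.Perm ([] ++ [i, j] ++ (w.erase i).erase j) :=
    (List.perm_cons_erase hiw).trans
      ((List.perm_cons_erase ((List.mem_erase_of_ne hij.symm).2 hjw)).cons i)
  have hc : ∀ i : Gen, 6 ≤ i → ∃ k, i = cGen k := by decide
  obtain ⟨a, rfl⟩ := hc i hi
  obtain ⟨b, rfl⟩ := hc j hj
  obtain ⟨r, hr, hcr⟩ := exists_semiPerfect_wordCongr_pair a b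
  have hmem : rootGen k ∈ r := by
    refine hr.rootGen_mem (hcr.1.mem_iff.1 ?_) (hcr.1.mem_iff.1 ?_)
    · exact List.mem_flatMap.2 ⟨_, by simp, hik⟩
    · exact List.mem_flatMap.2 ⟨_, by simp, hjk⟩
  have hlt := highDegree_lt (rootGen_lt k) hmem
  have hle := hno _ ((wordCongr_of_perm hp).trans (hcr.append [] _))
  rw [highDegree_perm hp, highDegree_append, highDegree_append, highDegree_append,
    highDegree_append, highDegree_cons, highDegree_cons, if_pos hi, if_pos hj] at hle
  have := hcr.1.length_eq
  simp only [expand_cons, List.length_append] at this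
  simp [highDegree] at hle
  simp [highDegree] at hlt
  simp at this
  omega

theorem ofWord_mem_sup (w : List Gen) :
    ofWord w ∈ relSub ⊔ Submodule.span ℂ (ofWord '' {w | SemiPerfect w}) := by
  induction hd : (expand w).length using Nat.strong_induction_on generalizing w with
  | _ d ihd =>
    induction hm : highDegree w using Nat.strong_induction_on generalizing w with
    | _ m ihm =>
      obtain ⟨v, hwv, hv⟩ : ∃ v, WordCongr w v ∧
          ofWord v ∈ relSub ⊔ Submodule.span ℂ (ofWord '' {w | SemiPerfect w}) := by
        by_cases hr : Reduced fun x => w.count x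
        · refine ⟨_, wordCongr_of_perm (List.perm_iff_count.2 fun x => ?_),
            Submodule.mem_sup_right (Submodule.subset_span ⟨_, hr.semiPerfect, rfl⟩)⟩
          rw [count_sortedWord]
        · obtain ⟨v, hwv, hlt⟩ := exists_wordCongr_highDegree_lt hr
          exact ⟨v, hwv, ihm _ (hm ▸ hlt) v (hwv.1.length_eq ▸ hd) rfl⟩
      have hlow : lowSpan d ≤ relSub ⊔ Submodule.span ℂ (ofWord '' {w | SemiPerfect w}) := by
        refine Submodule.span_le.2 ?_
        rintro _ ⟨u, hu, rfl⟩
        exact ihd _ hu u rfl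
      have := hwv.2
      rw [hd] at this
      rw [← sub_add_cancel (ofWord w) (ofWord v)]
      exact add_mem (sup_le le_sup_left hlow this) hv

theorem span_ofWord : Submodule.span ℂ (Set.range ofWord) = ⊤ := by
  refine Submodule.eq_top_iff'.2 fun x => ?_
  have hx : x ∈ Algebra.adjoin ℂ (Set.range (FreeAlgebra.ι ℂ : Gen → Free)) := by
    rw [FreeAlgebra.adjoin_range_ι]
    trivial
  rw [← Subalgebra.mem_toSubmodule, Algebra.adjoin_eq_span] at hx
  refine Submodule.span_mono ?_ hx
  intro v hv
  induction hv using Submonoid.closure_induction with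
  | mem _ hx => obtain ⟨x, rfl⟩ := hx; exact ⟨[x], by simp [ofWord]⟩
  | one => exact ⟨[], rfl⟩
  | mul _ _ _ _ ha hb =>
    obtain ⟨a, rfl⟩ := ha
    obtain ⟨b, rfl⟩ := hb
    exact ⟨a ++ b, ofWord_append a b⟩

theorem relIdeal_eq : relIdeal = K := by
  refine le_antisymm relIdeal_le fun x hx => ?_
  have h : (⊤ : Submodule ℂ Free) ≤
      relSub ⊔ Submodule.span ℂ (ofWord '' {w | SemiPerfect w}) := by
    rw [← span_ofWord]
    refine Submodule.span_le.2 ?_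
    rintro _ ⟨w, rfl⟩
    exact ofWord_mem_sup w
  obtain ⟨a, ha, n, hn, rfl⟩ := Submodule.mem_sup.1 (h (Submodule.mem_top (x := x)))
  have ha' := (TwoSidedIdeal.mem_ker _).1 (relIdeal_le ha)
  have hx' := (TwoSidedIdeal.mem_ker _).1 hx
  rw [map_add, ha', zero_add] at hx'
  rw [eq_zero_of_ω_eq_zero hn hx', add_zero]
  exact ha

end CentralizerC2

end

theorem mainTheorem6 :
    -- the listed monomials form a basis of `U₀(C₂)`
    (LinearIndependent ℂ
        (fun s : CentralizerC2.Exponents => CentralizerC2.monomial s.val) ∧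
      Submodule.span ℂ
        (Set.range fun s : CentralizerC2.Exponents => CentralizerC2.monomial s.val) =
          Subalgebra.toSubmodule CentralizerC2.U₀) ∧
    -- normal forms exist and are unique
    (∀ x : CentralizerC2.Free, ∃! n, CentralizerC2.IsNormalForm x n) ∧
    -- the relations of length two generate the ideal of relations
    TwoSidedIdeal.span
        (CentralizerC2.centralityRelations ∪ CentralizerC2.relationsOfLength 2) =
      CentralizerC2.K :=
  ⟨⟨CentralizerC2.linearIndependent_monomial, CentralizerC2.span_monomial⟩,
    CentralizerC2.existsUnique_isNormalForm, CentralizerC2.relIdeal_eq⟩
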